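/- Let $N, W, L, M$ be positive integers and let $w = (w[0],\dots,w[W-1]) \in \mathbb{C}^W$, extended by $w[k]=0$ for integers $k \notin [0,W-1]$. Put $R = \lceil (N+W-1)/L \rceil$, $f_m = (e^{2\pi i mn/N})_{0\le n\le N-1}$, and let $W_r$ be the $N\times N$ diagonal matrix with diagonal entries $w[rL-n]$, $0 \le n \le N-1$. For a signal $x_0 \in \mathbb{C}^N$ let $Z_w[m,r] = \bigl|\sum_{n=0}^{N-1} x_0[n]\,w[rL-n]\,e^{-2\pi i mn/N}\bigr|^2$ be its squared short-time Fourier transform magnitude, and call $X \in \mathbb{C}^{N\times N}$ feasible for the STliFT program if $X \succcurlyeq 0$ and $$Z_w[m,r] = \operatorname{trace}\bigl(W_r^\star f_m f_m^\star W_r X\bigr) \quad\text{for } 1\le m\le M,\ 0\le r\le R-1 .$$ Suppose that $w[n]\ne 0$ for all $0\le n\le W-1$, that $2L \le W \le N/2$ and that $4L\le M\le N$. Then almost all sparse signals $x_0$ (signals with at least one zero entry) that have at most $W-2L$ consecutive zeros have both of the following properties: (a) if $L=1$, then $X_0=x_0x_0^\star$ is the unique feasible matrix of the STliFT program; (b)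 for every $L \geq 1$, if $x_0[n]$ is known a priori for $i_0\le n<i_0+L$, where $i_0$ is the smallest index with $x_0[i_0]\neq 0$, that is, if the constraints $X[n,m]=x_0[n]\overline{x_0[m]}$ for $i_0\le n,m<i_0+L$ are added to the program, then $X_0=x_0x_0^\star$ is its unique feasible matrix. Here "at most $K$ consecutive zeros" means that any $K+1$ consecutive indices in $[0,N-1]$ include one at which $x_0$ is nonzero, and "almost all" means that, for every support $S\subsetneq\{0,\dots,N-1\}$, the signals with support exactly $S$ that have at most $W-2L$ consecutive zeros and for which the conclusion fails form a set of Lebesgue measure zero in $\mathbb{C}^S$. -/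

import Mathlib

open scoped ComplexOrder

namespace STliFT

noncomputable section

/-- The window `w[0], …, w[W-1]`, extended by zero to all integer indices. -/
def windowExt {W : ℕ} (w : Fin W → ℂ) (k : ℤ) : ℂ :=
  if h : 0 ≤ k ∧ k < (W : ℤ) then w ⟨k.toNat, by omega⟩ else 0

/-- The flipped and shifted window `w_r[n] = w[rL - n]`, for `0 ≤ n ≤ N-1`. -/
def shiftedWindow (N : ℕ) {W : ℕ} (w : Fin W → ℂ) (L r : ℕ) (n : Fin N) : ℂ :=
  windowExt w ((r : ℤ) * (L : ℤ) - ((n : ℕ) : ℤ))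

/-- The number of short-time sections `R = ⌈(N + W - 1) / L⌉`. -/
def numSections (N W L : ℕ) : ℕ := (N + W - 1) ⌈/⌉ L

/-- The STFT `Y_w[m, r] = ∑ n, x[n] w[rL - n] exp(-2πi m n / N)`. -/
def stft {N W : ℕ} (w : Fin W → ℂ) (L : ℕ) (x : Fin N → ℂ) (m r : ℕ) : ℂ :=
  ∑ n : Fin N, x n * shiftedWindow N w L r n *
    Complex.exp (-(Complex.I * 2 * Real.pi * ((m : ℂ) * ((n : ℕ) : ℂ) / (N : ℂ))))

/-- The measurements `Z_w[m, r] = |Y_w[m, r]|²`. -/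
def stftMagSq {N W : ℕ} (w : Fin W → ℂ) (L : ℕ) (x : Fin N → ℂ) (m r : ℕ) : ℝ :=
  ‖stft w L x m r‖ ^ 2

/-- The vector `f_m`, the conjugate of the `m`-th column of the `N`-point DFT matrix. -/
def fourierVec (N m : ℕ) : Fin N → ℂ := fun n =>
  Complex.exp (Complex.I * 2 * Real.pi * ((m : ℂ) * ((n : ℕ) : ℂ) / (N : ℂ)))

/-- The diagonal matrix `W_r` with diagonal `w_r`. -/
def windowMatrix (N : ℕ) {W : ℕ} (w : Fin W → ℂ) (L r : ℕ) : Matrix (Fin N) (Fin N) ℂ :=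
  Matrix.diagonal (shiftedWindow N w L r)

/-- The rank-one matrix `x x⋆`. -/
def outer {N : ℕ} (x : Fin N → ℂ) : Matrix (Fin N) (Fin N) ℂ :=
  Matrix.vecMulVec x (star x)

/-- `X` is feasible for the semidefinite program with the data generated by `x₀`:
`X ≽ 0` and `Z_w[m, r] = trace (W_r⋆ f_m f_m⋆ W_r X)` for `1 ≤ m ≤ M` and `0 ≤ r ≤ R - 1`. -/
def IsFeasible {N W : ℕ} (w : Fin W → ℂ) (L M : ℕ) (x₀ : Fin N → ℂ)
    (X : Matrix (Fin N) (Fin N) ℂ) : Prop :=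
  X.PosSemidef ∧
    ∀ m r : ℕ, 1 ≤ m → m ≤ M → r < numSections N W L →
      ((stftMagSq w L x₀ m r : ℝ) : ℂ) =
        ((windowMatrix N w L r).conjTranspose * outer (fourierVec N m) *
          windowMatrix N w L r * X).trace

/-- The constraints on `X` due to the knowledge of `x₀[n]` for `i₀ ≤ n < i₀ + L`. -/
def AgreesWithPrior {N : ℕ} (L : ℕ) (x₀ : Fin N → ℂ) (i₀ : Fin N)
    (X : Matrix (Fin N) (Fin N) ℂ) : Prop :=
  ∀ n m : Fin N, i₀ ≤ n → (n : ℕ) < (i₀ : ℕ) + L → i₀ ≤ m → (m : ℕ) < (i₀ : ℕ) + L →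
    X n m = x₀ n * star (x₀ m)

/-- The signal `x` has at most `K` consecutive zeros: among any `K + 1` consecutive indices
in `[0, N-1]` there is one at which `x` does not vanish. -/
def AtMostConsecutiveZeros {N : ℕ} (K : ℕ) (x : Fin N → ℂ) : Prop :=
  ∀ a : ℕ, a + K < N → ∃ n : Fin N, a ≤ (n : ℕ) ∧ (n : ℕ) ≤ a + K ∧ x n ≠ 0

/-- The signal with entries `v` on `S` and zero elsewhere. -/
def extendZero {N : ℕ} (S : Finset (Fin N)) (v : S → ℂ) : Fin N → ℂ :=
  fun n => if h : n ∈ S then v ⟨n, h⟩ else 0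

/-- `P` holds for almost all sparse signals of length `N` (a signal is sparse if it has at
least one zero): for every proper subset `S` of the indices, the signals with support exactly
`S` for which `P` fails form a Lebesgue null set in `ℂ^S`. -/
def AlmostAllSparse (N : ℕ) (P : (Fin N → ℂ) → Prop) : Prop :=
  ∀ S : Finset (Fin N), S ≠ Finset.univ →
    ∀ᵐ v : S → ℂ ∂MeasureTheory.volume, (∀ n, v n ≠ 0) → P (extendZero S v)

end

end STliFT

namespace STliFT

open Matrix

/-! ### Positive semidefinite matrices -/

/-! The sections are processed in order, and each one adds at most `L` new indices to the set `K` on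
which a feasible `X` is already known to equal `x₀ x₀⋆`. Since `X` is positive semidefinite,
splitting off its column at `i₀` gives `X = b b⋆ + D` with `D ≽ 0`, `b = x₀` on `K`, and `D` zero on
the rows and columns of `K`. With `β = b - x₀`, the error is `X - x₀ x₀⋆ = G + β x₀⋆ + x₀ β⋆`, where
`G = β β⋆ + D ≽ 0` lives outside `K`.

The measurements of the next section thus give homogeneous linear equations in the `2L - 1` diagonal
sums of the windowed `G`, the `L` windowed entries of `β` and their conjugates. These are `4L - 1`
unknowns, and `4L` frequencies are available. If the system is invertible, the windowed `G` has
trace zero, and positivity forces `β` and `D` to vanish on the section (`eq_outer_of_section`).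

Invertibility is generic (`ae_det_sectionSystem_ne_zero`): moving one nonzero entry of the signal
makes the determinant a polynomial whose leading coefficient is of Vandermonde type. The bound on
consecutive zeros supplies such an entry for every section. The induction starts from
`diag_eq_zero_of_lt` and the prior knowledge, which for `L = 1` follows from the measurements
(`agreesWithPrior_one`). -/

lemma PosSemidef.apply_eq_zero_of_diag {n : Type*} [Fintype n] [DecidableEq n]
    {X : Matrix n n ℂ} (hX : X.PosSemidef) {i : n} (hi : X i i = 0) (j : n) :
    X i j = 0 ∧ X j i = 0 := by
  have hdot := hX.dotProduct_mulVec_zero_iff (Pi.single i 1)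
  have hcol : X *ᵥ Pi.single i 1 = 0 := by
    rw [← hdot]
    simp [hi]
  have hji : X j i = 0 := by simpa using congrFun hcol j
  refine ⟨?_, hji⟩
  rw [← hX.isHermitian.apply, hji, star_zero]

/-- Schur complement of a positive semidefinite matrix with respect to one diagonal entry. -/
lemma PosSemidef.sub_vecMulVec {n : Type*} [Fintype n] [DecidableEq n]
    {X : Matrix n n ℂ} (hX : X.PosSemidef) {i : n} {a : ℂ} (ha : a ≠ 0)
    (hi : X i i = a * star a) :
    (X - vecMulVec (fun j => X j i / star a) (star fun j => X j i / star a)).PosSemidef := by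
  have hsa : star a ≠ 0 := star_ne_zero.2 ha
  -- Congruence by this elimination matrix clears row and column `i`.
  let P : Matrix n n ℂ := 1 - vecMulVec (Pi.single i 1) (fun j => X i j / X i i)
  convert hX.conjTranspose_mul_mul_same P using 1
  have hcol : ∀ j, X j i = star (X i j) := fun j => (hX.isHermitian.apply j i).symm
  have hii : X i i ≠ 0 := by rw [hi]; exact mul_ne_zero ha hsa
  have hreal : star (X i i) = X i i := hX.isHermitian.apply i i
  have key : ∀ j k, (Pᴴ * X * P) j k = X j k - X j i * X i k / X i i := by
    intro j k
    have h1 : X * P = X - vecMulVec (fun j => X j i) (fun j => X i j / X i i) := by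
      rw [mul_sub, mul_one, mul_vecMulVec]
      congr 2
      ext l
      simp
    rw [Matrix.mul_assoc, h1, show P = _ from rfl, conjTranspose_sub, conjTranspose_one, sub_mul, one_mul,
      conjTranspose_vecMulVec, mul_sub, vecMulVec_mul, vecMulVec_mul_vecMulVec]
    have hs : ∀ l, ∑ x, star (Pi.single (M := fun _ => ℂ) i 1 x) * X x l = X i l := fun l => by
      rw [Finset.sum_eq_single i] <;> simp +contextual
    simp only [Matrix.sub_apply, vecMulVec_apply, Pi.star_apply, dotProduct, vecMul, hs, star_div₀, Pi.smul_apply, smul_eq_mul,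
      hreal, hcol j]
    field_simp
    ring
  ext j k
  rw [key, hi, Matrix.sub_apply, vecMulVec_apply, Pi.star_apply, star_div₀, star_star, hX.isHermitian.apply i k]
  field_simp

/-! ### Exponential sums -/

/-- The root of unity `exp (-2πi / N)`. -/
noncomputable def dftRoot (N : ℕ) : ℂ := Complex.exp (-(2 * Real.pi * Complex.I / N))

lemma dftRoot_ne_zero (N : ℕ) : dftRoot N ≠ 0 := Complex.exp_ne_zero _

lemma isPrimitiveRoot_dftRoot {N : ℕ} (hN : N ≠ 0) : IsPrimitiveRoot (dftRoot N) N := by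
  rw [dftRoot, Complex.exp_neg]
  exact (Complex.isPrimitiveRoot_exp N hN).inv

lemma dftRoot_zpow (N : ℕ) (j : ℤ) :
    dftRoot N ^ j = Complex.exp (-(Complex.I * 2 * Real.pi * ((j : ℂ) / N))) := by
  rw [dftRoot, ← Complex.exp_int_mul]
  congr 1
  ring

lemma star_dftRoot_zpow (N : ℕ) (j : ℤ) : star (dftRoot N ^ j) = dftRoot N ^ (-j) := by
  rw [dftRoot_zpow, dftRoot_zpow, Complex.star_def, ← Complex.exp_conj]
  congr 1
  simp only [map_neg, map_mul, map_div₀, Complex.conj_I, Complex.conj_ofReal, map_ofNat,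
    map_intCast, map_natCast, Int.cast_neg]
  ring

/-- Vandermonde: exponents that are distinct modulo `N` give distinct nodes. -/
lemma eq_zero_of_sum_mul_dftRoot_zpow {J : Type*} [Fintype J] {N : ℕ} (hN : N ≠ 0) (e : J → ℤ)
    (he : ∀ i j, (N : ℤ) ∣ e i - e j → i = j) (v : J → ℂ)
    (h : ∀ k : ℕ, 1 ≤ k → k ≤ Fintype.card J →
      ∑ j, v j * dftRoot N ^ ((k : ℤ) * e j) = 0) : v = 0 := by
  let σ := Fintype.equivFin J
  have hz := dftRoot_ne_zero N
  have hinj : Function.Injective (fun i => dftRoot N ^ e (σ.symm i)) := by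
    intro i j hij
    apply σ.symm.injective
    apply he
    rw [← (isPrimitiveRoot_dftRoot hN).zpow_eq_one_iff_dvd, zpow_sub₀ hz]
    exact (div_eq_one_iff_eq (zpow_ne_zero _ hz)).2 hij
  -- The frequencies start at 1 instead of 0, so one power of each node is absorbed into its
  -- coefficient.
  have h0 := eq_zero_of_forall_pow_sum_mul_pow_eq_zero
    (v := fun i => v (σ.symm i) * dftRoot N ^ e (σ.symm i)) hinj (fun i => by
      have := h (i + 1) (by omega) (by omega)
      rw [← σ.symm.sum_comp] at this
      rw [← this]
      refine Finset.sum_congr rfl fun j _ => ?_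
      rw [mul_assoc, ← zpow_natCast, ← _root_.zpow_mul, ← zpow_add₀ hz]
      congr 2
      push_cast
      ring)
  ext j
  have := congrFun h0 (σ j)
  simpa [zpow_ne_zero _ hz] using this

/-- The trigonometric polynomial of a matrix at frequency `k`: the sum of
`G n m * exp (-2πi k (n - m) / N)`. -/
noncomputable def trigSum {N : ℕ} (G : Matrix (Fin N) (Fin N) ℂ) (k : ℕ) : ℂ :=
  ∑ n : Fin N, ∑ m : Fin N, G n m * dftRoot N ^ ((k : ℤ) * (((n : ℕ) : ℤ) - ((m : ℕ) : ℤ)))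

/-- The sum of the entries of a matrix along its `d`-th diagonal. -/
noncomputable def diagSum {N : ℕ} (G : Matrix (Fin N) (Fin N) ℂ) (d : ℤ) : ℂ :=
  ∑ n : Fin N, ∑ m : Fin N, if ((n : ℕ) : ℤ) - ((m : ℕ) : ℤ) = d then G n m else 0

lemma diagSum_zero_eq_trace {N : ℕ} (G : Matrix (Fin N) (Fin N) ℂ) : diagSum G 0 = G.trace := by
  refine Finset.sum_congr rfl fun n _ => ?_
  rw [Finset.sum_eq_single n]
  · simp
  · intro m _ hm
    rw [if_neg]
    intro h
    apply hm
    ext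
    omega
  · simp

lemma trigSum_eq_sum_diagSum {N L c : ℕ} {G : Matrix (Fin N) (Fin N) ℂ}
    (hG : ∀ n m, G n m ≠ 0 → (c ≤ (n : ℕ) ∧ (n : ℕ) < c + L) ∧ (c ≤ (m : ℕ) ∧ (m : ℕ) < c + L))
    (k : ℕ) :
    trigSum G k = ∑ d : Fin (2 * L - 1), diagSum G ((d : ℕ) + 1 - L) *
      dftRoot N ^ ((k : ℤ) * (((d : ℕ) : ℤ) + 1 - L)) := by
  simp only [diagSum, Finset.sum_mul]
  rw [Finset.sum_comm]
  refine Finset.sum_congr rfl fun n _ => ?_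
  rw [Finset.sum_comm]
  refine Finset.sum_congr rfl fun m _ => ?_
  by_cases h : G n m = 0
  · simp [h]
  obtain ⟨⟨h1, h2⟩, h3, h4⟩ := hG n m h
  rw [Finset.sum_eq_single ⟨(n : ℕ) + L - 1 - m, by omega⟩]
  · have : ((((n : ℕ) + L - 1 - m : ℕ) : ℤ)) + 1 - L = (n : ℕ) - (m : ℕ) := by omega
    simp only [this, if_true]
  · intro d _ hd
    rw [if_neg, zero_mul]
    intro h
    apply hd
    ext
    simp only
    omega
  · simp

/-- A block of length `L` meets only the diagonals `|d| < L`, whose offsets are distinct modulo `N`.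
All diagonal sums therefore vanish, and the trace is the one with `d = 0`. -/
lemma trace_eq_zero_of_trigSum {N L c : ℕ} (hL : 1 ≤ L) (hN : 2 * L ≤ N)
    {G : Matrix (Fin N) (Fin N) ℂ}
    (hG : ∀ n m, G n m ≠ 0 → (c ≤ (n : ℕ) ∧ (n : ℕ) < c + L) ∧ (c ≤ (m : ℕ) ∧ (m : ℕ) < c + L))
    (h : ∀ k, 1 ≤ k → k ≤ 2 * L → trigSum G k = 0) : G.trace = 0 := by
  have h0 := eq_zero_of_sum_mul_dftRoot_zpow (J := Fin (2 * L - 1)) (N := N) (by omega)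
    (fun d => ((d : ℕ) : ℤ) + 1 - L) (fun i j hij => by
      obtain ⟨q, hq⟩ := hij
      have hq0 : q = 0 := by
        have := i.2
        have := j.2
        by_contra hne
        have h3 : (N : ℤ) ≤ |(N : ℤ) * q| := by
          rw [abs_mul, Nat.abs_cast]
          exact le_mul_of_one_le_right (by positivity) (Int.one_le_abs hne)
        rw [← hq] at h3
        rcases abs_cases ((((i : ℕ) : ℤ) + 1 - L) - (((j : ℕ) : ℤ) + 1 - L)) <;> omega
      subst hq0
      ext
      omega)
    (fun d => diagSum G ((d : ℕ) + 1 - L)) (fun k hk1 hk2 => by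
      rw [← trigSum_eq_sum_diagSum hG]
      rw [Fintype.card_fin] at hk2
      exact h k hk1 (by omega))
  have := congrFun h0 ⟨L - 1, by omega⟩
  have e : (((L - 1 : ℕ) : ℤ)) + 1 - L = 0 := by omega
  simp only [e, Pi.zero_apply] at this
  rw [← diagSum_zero_eq_trace, this]

/-! ### The measurements as trigonometric polynomials -/

lemma shiftedWindow_ne_zero_iff {N W : ℕ} {w : Fin W → ℂ} (hw : ∀ n, w n ≠ 0) (L r : ℕ)
    (n : Fin N) : shiftedWindow N w L r n ≠ 0 ↔ (n : ℕ) ≤ r * L ∧ r * L < n + W := by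
  rw [shiftedWindow, windowExt]
  have hc : ((r * L : ℕ) : ℤ) = (r : ℤ) * L := by push_cast; rfl
  split_ifs with h
  · simp only [ne_eq, hw, not_false_eq_true, true_iff]
    omega
  · simp only [ne_eq, not_true_eq_false, false_iff]
    omega

/-- The matrix `X` multiplied entrywise by the window of the `r`-th section. -/
noncomputable def windowed {N W : ℕ} (w : Fin W → ℂ) (L r : ℕ) (X : Matrix (Fin N) (Fin N) ℂ) :
    Matrix (Fin N) (Fin N) ℂ :=
  Matrix.of fun n m => X n m * (shiftedWindow N w L r n * star (shiftedWindow N w L r m))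

lemma fourierVec_eq (N m : ℕ) (n : Fin N) :
    fourierVec N m n = dftRoot N ^ (-((m : ℤ) * ((n : ℕ) : ℤ))) := by
  rw [fourierVec, dftRoot_zpow]
  congr 1
  push_cast
  ring

lemma trace_eq_trigSum {N W : ℕ} (w : Fin W → ℂ) (L r k : ℕ) (X : Matrix (Fin N) (Fin N) ℂ) :
    ((windowMatrix N w L r).conjTranspose * outer (fourierVec N k) *
      windowMatrix N w L r * X).trace = trigSum (windowed w L r X) k := by
  rw [trace_mul_comm]
  simp only [Matrix.trace, diag_apply, trigSum, Matrix.mul_apply (M := X)]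
  refine Finset.sum_congr rfl fun n _ => Finset.sum_congr rfl fun m _ => ?_
  rw [windowMatrix, diagonal_conjTranspose, mul_diagonal, diagonal_mul, outer, vecMulVec_apply,
    Pi.star_apply, Pi.star_apply, fourierVec_eq, fourierVec_eq, star_dftRoot_zpow, windowed,
    Matrix.of_apply, neg_neg, mul_sub, sub_eq_add_neg, zpow_add₀ (dftRoot_ne_zero N)]
  ring

lemma stft_eq {N W : ℕ} (w : Fin W → ℂ) (L : ℕ) (x : Fin N → ℂ) (k r : ℕ) :
    stft w L x k r = ∑ n : Fin N, x n * shiftedWindow N w L r n *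
      dftRoot N ^ ((k : ℤ) * ((n : ℕ) : ℤ)) := by
  refine Finset.sum_congr rfl fun n _ => ?_
  rw [dftRoot_zpow]
  congr 2
  push_cast
  ring

/-- Two different vectors are allowed because the cross terms `β x₀⋆` and `x₀ β⋆` are measured too.
-/
lemma trigSum_vecMulVec {N W : ℕ} (w : Fin W → ℂ) (L r k : ℕ) (x y : Fin N → ℂ) :
    trigSum (windowed w L r (vecMulVec x (star y))) k =
      stft w L x k r * star (stft w L y k r) := by
  rw [stft_eq, stft_eq, star_sum, Finset.sum_mul_sum, trigSum]
  refine Finset.sum_congr rfl fun n _ => Finset.sum_congr rfl fun m _ => ?_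
  rw [windowed, Matrix.of_apply, vecMulVec_apply, star_mul', star_mul', star_dftRoot_zpow, mul_sub,
    sub_eq_add_neg, zpow_add₀ (dftRoot_ne_zero N), Pi.star_apply]
  ring

lemma stftMagSq_eq_trigSum {N W : ℕ} (w : Fin W → ℂ) (L r k : ℕ) (x : Fin N → ℂ) :
    ((stftMagSq w L x k r : ℝ) : ℂ) = trigSum (windowed w L r (outer x)) k := by
  rw [outer, trigSum_vecMulVec, stftMagSq, Complex.star_def, Complex.mul_conj,
    Complex.normSq_eq_norm_sq]

lemma trigSum_add {N : ℕ} (G H : Matrix (Fin N) (Fin N) ℂ) (k : ℕ) :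
    trigSum (G + H) k = trigSum G k + trigSum H k := by
  simp [trigSum, add_mul, Finset.sum_add_distrib]

lemma trigSum_sub {N : ℕ} (G H : Matrix (Fin N) (Fin N) ℂ) (k : ℕ) :
    trigSum (G - H) k = trigSum G k - trigSum H k := by
  simp [trigSum, sub_mul, Finset.sum_sub_distrib]

lemma windowed_add {N W : ℕ} (w : Fin W → ℂ) (L r : ℕ) (X Y : Matrix (Fin N) (Fin N) ℂ) :
    windowed w L r (X + Y) = windowed w L r X + windowed w L r Y := by
  ext n m
  simp [windowed, add_mul]

lemma windowed_sub {N W : ℕ} (w : Fin W → ℂ) (L r : ℕ) (X Y : Matrix (Fin N) (Fin N) ℂ) :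
    windowed w L r (X - Y) = windowed w L r X - windowed w L r Y := by
  ext n m
  simp [windowed, sub_mul]

lemma isFeasible_iff {N W : ℕ} (w : Fin W → ℂ) (L M : ℕ) (x₀ : Fin N → ℂ)
    (X : Matrix (Fin N) (Fin N) ℂ) :
    IsFeasible w L M x₀ X ↔ X.PosSemidef ∧ ∀ k r : ℕ, 1 ≤ k → k ≤ M → r < numSections N W L →
      trigSum (windowed w L r (X - outer x₀)) k = 0 := by
  simp only [IsFeasible, trace_eq_trigSum, stftMagSq_eq_trigSum, windowed_sub, trigSum_sub,
    sub_eq_zero]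
  simp only [eq_comm]

lemma isFeasible_outer {N W : ℕ} (w : Fin W → ℂ) (L M : ℕ) (x₀ : Fin N → ℂ) :
    IsFeasible w L M x₀ (outer x₀) := by
  rw [isFeasible_iff]
  refine ⟨posSemidef_vecMulVec_self_star x₀, fun k r _ _ _ => ?_⟩
  simp [trigSum, windowed]

/-! ### Generic invertibility of the linear system of a section -/

/-- The indices of the unknowns of a section: the `2L - 1` diagonal sums of the new block, the
`L` new entries of the signal and their conjugates. -/
abbrev SectionIndex (L : ℕ) : Type := Fin (2 * L - 1) ⊕ (Fin L ⊕ Fin L)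

/-- The frequency that is used for the `i`-th equation of the system of a section. -/
noncomputable def sectionFreq {L : ℕ} (i : SectionIndex L) : ℕ := Fintype.equivFin _ i + 1

lemma card_sectionIndex {L : ℕ} (hL : 1 ≤ L) : Fintype.card (SectionIndex L) = 4 * L - 1 := by
  simp only [Fintype.card_sum, Fintype.card_fin]
  omega

lemma sectionFreq_le {L : ℕ} (hL : 1 ≤ L) (i : SectionIndex L) : sectionFreq i ≤ 4 * L := by
  have h := (Fintype.equivFin _ i).2
  have h2 := card_sectionIndex hL
  rw [sectionFreq]
  omega

lemma exists_sectionFreq_eq {L k : ℕ} (hk : 1 ≤ k) (hk' : k ≤ Fintype.card (SectionIndex L)) :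
    ∃ i : SectionIndex L, sectionFreq i = k :=
  ⟨(Fintype.equivFin _).symm ⟨k - 1, by omega⟩, by
    rw [sectionFreq, Equiv.apply_symm_apply]
    simp only
    omega⟩

/-- The matrix of the linear system that expresses that the perturbation of the `L` entries from
the index `c` on does not change the measurements of a section with Fourier transform `y`. -/
noncomputable def sectionSystem (N L c : ℕ) (y : ℕ → ℂ) :
    Matrix (SectionIndex L) (SectionIndex L) ℂ :=
  Matrix.of fun i => Sum.elim
    (fun d => dftRoot N ^ ((sectionFreq i : ℤ) * (((d : ℕ) : ℤ) + 1 - L)))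
    (Sum.elim
      (fun j => star (y (sectionFreq i)) *
        dftRoot N ^ ((sectionFreq i : ℤ) * ((c : ℤ) + ((j : ℕ) : ℤ))))
      (fun j => y (sectionFreq i) *
        dftRoot N ^ (-((sectionFreq i : ℤ) * ((c : ℤ) + ((j : ℕ) : ℤ))))))

/-- Treating `p'` as independent of `p`, although it will be `star p`, makes the equations
complex-linear, so a determinant decides. -/
lemma eq_zero_of_sectionSystem {N L c : ℕ} (hL : 1 ≤ L) {y : ℕ → ℂ}
    (hdet : (sectionSystem N L c y).det ≠ 0)
    {q : Fin (2 * L - 1) → ℂ} {p p' : Fin L → ℂ}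
    (h : ∀ k : ℕ, 1 ≤ k → k ≤ 4 * L →
      (∑ d, q d * dftRoot N ^ ((k : ℤ) * (((d : ℕ) : ℤ) + 1 - L))) +
        (star (y k) * (∑ j, p j * dftRoot N ^ ((k : ℤ) * ((c : ℤ) + ((j : ℕ) : ℤ)))) +
        y k * ∑ j, p' j * dftRoot N ^ (-((k : ℤ) * ((c : ℤ) + ((j : ℕ) : ℤ))))) = 0) :
    q = 0 := by
  have h0 := Matrix.eq_zero_of_mulVec_eq_zero hdet (v := Sum.elim q (Sum.elim p p')) (by
    ext i
    rw [Pi.zero_apply, ← h (sectionFreq i) (by simp [sectionFreq]) (sectionFreq_le hL i)]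
    simp only [mulVec, dotProduct, Fintype.sum_sum_type, sectionSystem, Matrix.of_apply,
      Sum.elim_inl, Sum.elim_inr, Finset.mul_sum]
    congr 1
    · exact Finset.sum_congr rfl fun _ _ => mul_comm _ _
    · congr 1 <;> exact Finset.sum_congr rfl fun _ _ => by ring)
  ext d
  exact congrFun h0 (Sum.inl d)

/-- The determinant is a polynomial in `t` whose coefficient in degree `card J` is `B.det`. -/
lemma finite_det_smul_add_eq_zero {J : Type*} [Fintype J] [DecidableEq J] (A B : Matrix J J ℂ)
    (hB : B.det ≠ 0) : {t : ℝ | ((t : ℂ) • B + A).det = 0}.Finite := by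
  let P : Polynomial ℂ := det ((Polynomial.X : Polynomial ℂ) • B.map Polynomial.C +
    A.map Polynomial.C)
  have hP : P ≠ 0 := by
    intro h
    apply hB
    rw [← Polynomial.coeff_det_X_add_C_card B A]
    change P.coeff _ = 0
    rw [h, Polynomial.coeff_zero]
  have heval : ∀ t : ℂ, P.eval t = (t • B + A).det := by
    intro t
    change Polynomial.evalRingHom t P = _
    rw [RingHom.map_det]
    congr 1
    ext i j
    simp [mul_comm t]
  have hfin : {t : ℂ | P.IsRoot t}.Finite := Polynomial.finite_setOfPred_isRoot hP
  refine (hfin.preimage Complex.ofReal_injective.injOn).subset fun t ht => ?_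
  change P.eval (t : ℂ) = 0
  rw [heval]
  exact ht

/-- The exponents of the system of a section with a single nonzero entry at distance `s` before
the new entries. -/
def sectionExponent {L : ℕ} (s : ℤ) : SectionIndex L → ℤ :=
  Sum.elim (fun d => ((d : ℕ) : ℤ) + 1 - L)
    (Sum.elim (fun j => s + ((j : ℕ) : ℤ)) (fun j => -(s + ((j : ℕ) : ℤ))))

/-- As `s ≥ L`, the three ranges `(-L, L)`, `[s, s + L)` and `(-s - L, -s]` are disjoint, and
differences are at most `2(s + L) - 2 < N`. -/
lemma sectionExponent_injective_mod {N L : ℕ} {s : ℤ} (hs : (L : ℤ) ≤ s)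
    (hN : 2 * (s + L) ≤ N) (i j : SectionIndex L)
    (h : (N : ℤ) ∣ sectionExponent s i - sectionExponent s j) : i = j := by
  have hb : ∀ i : SectionIndex L, |sectionExponent s i| ≤ s + L - 1 := by
    intro i
    rw [abs_le]
    rcases i with i | i | i <;> have := i.2 <;> simp only [sectionExponent, Sum.elim_inl,
      Sum.elim_inr] <;> constructor <;> omega
  have heq : sectionExponent s i = sectionExponent s j := by
    refine sub_eq_zero.1 (Int.eq_zero_of_abs_lt_dvd h ?_)
    have := abs_sub (sectionExponent s i) (sectionExponent s j)
    have := hb i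
    have := hb j
    omega
  rcases i with i | i | i <;> rcases j with j | j | j <;>
    have := i.2 <;> have := j.2 <;>
    simp only [sectionExponent, Sum.elim_inl, Sum.elim_inr] at heq <;>
    first
    | (exfalso; omega)
    | (have : i = j := by ext; omega
       rw [this])

lemma extendZero_add_smul_single {N : ℕ} (S : Finset (Fin N)) (v : S → ℂ) (a : S) (t : ℝ)
    (n : Fin N) :
    extendZero S (v + t • (Pi.single a 1 : S → ℂ)) n =
      extendZero S v n + if n = (a : Fin N) then (t : ℂ) else 0 := by
  unfold extendZero
  by_cases hn : n ∈ S
  · simp only [hn, dite_true, Pi.add_apply, Pi.smul_apply, Pi.single_apply, Subtype.ext_iff]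
    split_ifs <;> simp
  · have : n ≠ a := fun h => hn (h ▸ a.2)
    simp [hn, this]

lemma stft_extendZero_add_smul_single {N W : ℕ} (w : Fin W → ℂ) (L : ℕ) (S : Finset (Fin N))
    (v : S → ℂ) (a : S) (t : ℝ) (k r : ℕ) :
    stft w L (extendZero S (v + t • (Pi.single a 1 : S → ℂ))) k r = stft w L (extendZero S v) k r +
      t * (shiftedWindow N w L r a * dftRoot N ^ ((k : ℤ) * (((a : Fin N) : ℕ) : ℤ))) := by
  simp only [stft_eq, extendZero_add_smul_single, add_mul, Finset.sum_add_distrib, ite_mul,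
    zero_mul, Finset.sum_ite_eq', Finset.mem_univ, if_true, mul_assoc]

lemma continuous_stft_extendZero {N W : ℕ} (w : Fin W → ℂ) (L : ℕ) (S : Finset (Fin N))
    (k r : ℕ) : Continuous fun v : S → ℂ => stft w L (extendZero S v) k r := by
  unfold stft extendZero
  refine continuous_finsetSum _ fun n _ => ?_
  refine Continuous.mul (Continuous.mul ?_ continuous_const) continuous_const
  split_ifs with h
  · exact continuous_apply _
  · exact continuous_const

/-- By Fubini it suffices to vary the entry at `a` along real lines. As that entry grows it
dominates `y`, and the system tends to one with pure exponential columns. -/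
lemma ae_det_sectionSystem_ne_zero {N W L : ℕ} {w : Fin W → ℂ}
    (hw : ∀ n, w n ≠ 0) (hWN : 2 * W ≤ N) (S : Finset (Fin N)) (a : S) {r c : ℕ}
    (ha : ((a : Fin N) : ℕ) ≤ r * L) (ha' : r * L < ((a : Fin N) : ℕ) + W)
    (hac : ((a : Fin N) : ℕ) + L ≤ c) (hca : c + L ≤ ((a : Fin N) : ℕ) + W) :
    ∀ᵐ v : S → ℂ ∂MeasureTheory.volume,
      (sectionSystem N L c fun k => stft w L (extendZero S v) k r).det ≠ 0 := by
  have hwa : shiftedWindow N w L r (a : Fin N) ≠ 0 := (shiftedWindow_ne_zero_iff hw L r (a : Fin N)).2 ⟨ha, ha'⟩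
  set s : ℤ := (c : ℤ) - ((a : Fin N) : ℕ) with hs
  have hmeas : MeasurableSet {v : S → ℂ |
      (sectionSystem N L c fun k => stft w L (extendZero S v) k r).det ≠ 0} := by
    refine (isOpen_ne_fun (Continuous.matrix_det (continuous_matrix fun i j => ?_))
      continuous_const).measurableSet
    have hc := continuous_stft_extendZero w L S (sectionFreq i) r
    rcases j with j | j | j <;>
      simp only [sectionSystem, Matrix.of_apply, Sum.elim_inl, Sum.elim_inr] <;> fun_prop
  refine MeasureTheory.ae_mem_of_ae_add_linearMap_mem
    (LinearMap.toSpanSingleton ℝ (S → ℂ) (Pi.single a 1)) MeasureTheory.volume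
    MeasureTheory.volume hmeas fun v => ?_
  -- The part linear in `t`: the factor `z ^ (∓ka)` from the entry at `a` shifts the exponents `±(c
  -- + j)` to `±(s + j)`.
  let B : Matrix (SectionIndex L) (SectionIndex L) ℂ := Matrix.of fun i j =>
    (Sum.elim (fun _ => 1) (Sum.elim (fun _ => star (shiftedWindow N w L r a))
      (fun _ => shiftedWindow N w L r a)) j : ℂ) *
        dftRoot N ^ ((sectionFreq i : ℤ) * sectionExponent s j)
  let A : Matrix (SectionIndex L) (SectionIndex L) ℂ := Matrix.of fun i =>
    Sum.elim (fun _ => 0) fun j =>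
      sectionSystem N L c (fun k => stft w L (extendZero S v) k r) i (Sum.inr j)
  have hB : B.det ≠ 0 := by
    intro h0
    obtain ⟨u, hu, hBu⟩ := Matrix.exists_mulVec_eq_zero_iff.2 h0
    have h1 := eq_zero_of_sum_mul_dftRoot_zpow (N := N) (by omega) (sectionExponent s)
      (sectionExponent_injective_mod (N := N) (L := L) (s := s) (by omega) (by omega))
      (fun j => (Sum.elim (fun _ => 1) (Sum.elim (fun _ => star (shiftedWindow N w L r a))
        (fun _ => shiftedWindow N w L r a)) j : ℂ) * u j) (fun k hk hk' => by
        obtain ⟨i, rfl⟩ := exists_sectionFreq_eq hk hk'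
        rw [← Pi.zero_apply (M := fun _ => ℂ) i, ← hBu]
        simp only [mulVec, dotProduct]
        refine Finset.sum_congr rfl fun j _ => ?_
        simp only [B, Matrix.of_apply]
        ring)
    apply hu
    ext j
    have := congrFun h1 j
    rcases j with j | j | j <;> simpa [hwa] using this
  have hfin := finite_det_smul_add_eq_zero A B hB
  filter_upwards [hfin.measure_zero MeasureTheory.volume |> MeasureTheory.measure_eq_zero_iff_ae_notMem.1]
    with t ht hdet
  apply ht
  -- The diagonal-sum columns do not depend on `t`. Scaling them by `t` puts the system in the form
  -- `t • B + A` and loses no zero of the determinant.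
  have hmul : (t : ℂ) • B + A = (sectionSystem N L c fun k => stft w L
      (extendZero S (v + LinearMap.toSpanSingleton ℝ (S → ℂ) (Pi.single a 1) t)) k r) *
      diagonal (Sum.elim (fun _ => (t : ℂ)) (fun _ => 1)) := by
    ext i j
    have hz := dftRoot_ne_zero N
    rw [mul_diagonal]
    rcases j with j | j | j <;>
      simp only [A, B, sectionSystem, Matrix.of_apply, Sum.elim_inl, Sum.elim_inr,
        Matrix.add_apply, Matrix.smul_apply, smul_eq_mul, sectionExponent,
        LinearMap.toSpanSingleton_apply, stft_extendZero_add_smul_single, star_add, star_mul',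
        star_dftRoot_zpow]
    · ring
    · rw [show (sectionFreq i : ℤ) * (s + ((j : ℕ) : ℤ)) =
        -((sectionFreq i : ℤ) * (((a : Fin N) : ℕ) : ℤ)) +
          (sectionFreq i : ℤ) * ((c : ℤ) + ((j : ℕ) : ℤ)) by rw [hs]; ring, zpow_add₀ hz]
      simp only [Complex.star_def, Complex.conj_ofReal]
      ring
    · rw [show (sectionFreq i : ℤ) * -(s + ((j : ℕ) : ℤ)) =
        (sectionFreq i : ℤ) * (((a : Fin N) : ℕ) : ℤ) +
          -((sectionFreq i : ℤ) * ((c : ℤ) + ((j : ℕ) : ℤ))) by rw [hs]; ring, zpow_add₀ hz]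
      ring
  change (_ : ℂ) = 0
  rw [hmul, det_mul, hdet, zero_mul]

/-! ### Propagation through the sections -/

lemma lt_numSections_iff {N W L r : ℕ} (hL : 1 ≤ L) :
    r < numSections N W L ↔ r * L < N + W - 1 := by
  rw [numSections, ← not_le, ceilDiv_le_iff_le_mul hL, not_le, mul_comm]

lemma stft_eq_sum_of_support {N W L c : ℕ} {w : Fin W → ℂ} {x : Fin N → ℂ} {r : ℕ}
    (hx : ∀ n, x n * shiftedWindow N w L r n ≠ 0 → c ≤ (n : ℕ) ∧ (n : ℕ) < c + L) (k : ℕ) :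
    stft w L x k r = ∑ j : Fin L,
      (∑ n : Fin N, if (n : ℕ) = c + j then x n * shiftedWindow N w L r n else 0) *
        dftRoot N ^ ((k : ℤ) * ((c : ℤ) + ((j : ℕ) : ℤ))) := by
  rw [stft_eq]
  simp only [Finset.sum_mul]
  rw [Finset.sum_comm]
  refine Finset.sum_congr rfl fun n _ => ?_
  by_cases h : x n * shiftedWindow N w L r n = 0
  · simp [h]
  obtain ⟨h1, h2⟩ := hx n h
  rw [Finset.sum_eq_single ⟨(n : ℕ) - c, by omega⟩]
  · have h3 : c + ((n : ℕ) - c) = n := by omega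
    have h4 : (c : ℤ) + (((n : ℕ) - c : ℕ) : ℤ) = (n : ℕ) := by omega
    simp only [h3, h4, if_true]
  · intro j _ hj
    rw [if_neg, zero_mul]
    intro h
    apply hj
    ext
    simp only
    omega
  · simp

/-- A positive semidefinite matrix that agrees with `x₀ x₀⋆` on the block of the indices in `K`
and has the same measurements in the `r`-th section agrees with it on the indices of that
section as well, provided that the linear system of the section is invertible. -/
lemma eq_outer_of_section {N W L : ℕ} (hL : 1 ≤ L) {w : Fin W → ℂ} (hw : ∀ n, w n ≠ 0)
    {x₀ : Fin N → ℂ} {X : Matrix (Fin N) (Fin N) ℂ} (hX : X.PosSemidef) {i₀ : Fin N}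
    (hi₀ : x₀ i₀ ≠ 0) {K : Set (Fin N)} (hiK : i₀ ∈ K)
    (hK : ∀ n ∈ K, ∀ m ∈ K, X n m = outer x₀ n m) {r c : ℕ}
    (hc : ∀ n : Fin N, n ∉ K → (n : ℕ) ≤ r * L → r * L < (n : ℕ) + W →
      c ≤ (n : ℕ) ∧ (n : ℕ) < c + L)
    (hdet : (sectionSystem N L c fun k => stft w L x₀ k r).det ≠ 0)
    (htrig : ∀ k : ℕ, 1 ≤ k → k ≤ 4 * L → trigSum (windowed w L r (X - outer x₀)) k = 0)
    {n m : Fin N} (hn : n ∈ K ∨ ((n : ℕ) ≤ r * L ∧ r * L < (n : ℕ) + W))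
    (hm : m ∈ K ∨ ((m : ℕ) ≤ r * L ∧ r * L < (m : ℕ) + W)) :
    X n m = outer x₀ n m := by
  set b : Fin N → ℂ := fun j => X j i₀ / star (x₀ i₀) with hb
  have hsi : star (x₀ i₀) ≠ 0 := star_ne_zero.2 hi₀
  have hbK : ∀ n ∈ K, b n = x₀ n := fun n hn => by
    rw [hb]
    simp only
    rw [hK n hn i₀ hiK, outer, vecMulVec_apply, Pi.star_apply, mul_div_cancel_right₀ _ hsi]
  set D : Matrix (Fin N) (Fin N) ℂ := X - vecMulVec b (star b) with hD
  have hDpos : D.PosSemidef := PosSemidef.sub_vecMulVec hX hi₀ (hK i₀ hiK i₀ hiK)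
  have hDK : ∀ n ∈ K, D n n = 0 := fun n hn => by
    rw [hD, Matrix.sub_apply, hK n hn n hn, outer, vecMulVec_apply, vecMulVec_apply, Pi.star_apply,
      Pi.star_apply, hbK n hn, sub_self]
  set β : Fin N → ℂ := b - x₀ with hβ
  have hβK : ∀ n ∈ K, β n = 0 := fun n hn => by
    rw [hβ, Pi.sub_apply, hbK n hn, sub_self]
  set G : Matrix (Fin N) (Fin N) ℂ := vecMulVec β (star β) + D with hG
  clear_value G
  have hGK : ∀ n m, G n m ≠ 0 → n ∉ K ∧ m ∉ K := by
    intro n m h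
    constructor <;> intro hk <;> apply h <;>
      simp [hG, vecMulVec_apply, hβK _ hk, PosSemidef.apply_eq_zero_of_diag hDpos (hDK _ hk)]
  -- Expand `b = x₀ + β` in `b b⋆ + D`.
  have hE : X - outer x₀ = G + (vecMulVec β (star x₀) + vecMulVec x₀ (star β)) := by
    ext n m
    simp only [hG, hD, hβ, outer, Matrix.add_apply, Matrix.sub_apply, vecMulVec_apply,
      Pi.star_apply, Pi.sub_apply, star_sub]
    ring
  have hwin : ∀ n, shiftedWindow N w L r n ≠ 0 → n ∉ K → c ≤ (n : ℕ) ∧ (n : ℕ) < c + L :=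
    fun n h hk => by
      obtain ⟨h1, h2⟩ := (shiftedWindow_ne_zero_iff hw L r n).1 h
      exact hc n hk h1 h2
  have hβs : ∀ n, β n * shiftedWindow N w L r n ≠ 0 → c ≤ (n : ℕ) ∧ (n : ℕ) < c + L := fun n h =>
    hwin n (right_ne_zero_of_mul h) fun hk => left_ne_zero_of_mul h (hβK n hk)
  have hGs : ∀ n m, windowed w L r G n m ≠ 0 →
      (c ≤ (n : ℕ) ∧ (n : ℕ) < c + L) ∧ (c ≤ (m : ℕ) ∧ (m : ℕ) < c + L) := by
    intro n m h
    rw [windowed, Matrix.of_apply] at h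
    obtain ⟨h1, h2⟩ := hGK n m (left_ne_zero_of_mul h)
    have h3 := right_ne_zero_of_mul h
    exact ⟨hwin n (left_ne_zero_of_mul h3) h1,
      hwin m (star_ne_zero.1 (right_ne_zero_of_mul h3)) h2⟩
  set p : Fin L → ℂ := fun j =>
    ∑ n : Fin N, if (n : ℕ) = c + j then β n * shiftedWindow N w L r n else 0 with hp
  have hq := eq_zero_of_sectionSystem hL hdet
    (q := fun d => diagSum (windowed w L r G) ((d : ℕ) + 1 - L)) (p := p) (p' := star p)
    (fun k hk hk' => by
      rw [← htrig k hk hk', hE, windowed_add, trigSum_add,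
        windowed_add, trigSum_add, trigSum_vecMulVec, trigSum_vecMulVec, trigSum_eq_sum_diagSum hGs,
        stft_eq_sum_of_support hβs, star_sum]
      simp only [star_mul', star_dftRoot_zpow, Pi.star_apply, hp]
      ring)
  have htr : (windowed w L r G).trace = 0 := by
    rw [← diagSum_zero_eq_trace]
    -- Position `L - 1` in `Fin (2 * L - 1)` is the main diagonal.
    have := congrFun hq ⟨L - 1, by omega⟩
    have e : (((L - 1 : ℕ) : ℤ)) + 1 - L = 0 := by omega
    simpa only [e, Pi.zero_apply] using this
  have hzero : ∀ n, (n ∈ K ∨ ((n : ℕ) ≤ r * L ∧ r * L < (n : ℕ) + W)) → β n = 0 ∧ D n n = 0 := by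
    rintro n (hk | hk)
    · exact ⟨hβK n hk, hDK n hk⟩
    have hterm : ∀ n, 0 ≤ windowed w L r G n n := fun n => by
      rw [windowed, Matrix.of_apply, hG, Matrix.add_apply, vecMulVec_apply]
      exact mul_nonneg (add_nonneg (mul_star_self_nonneg _) hDpos.diag_nonneg)
        (mul_star_self_nonneg _)
    have h0 := (Finset.sum_eq_zero_iff_of_nonneg fun n _ => hterm n).1 htr n (Finset.mem_univ n)
    have hwn := (shiftedWindow_ne_zero_iff hw L r n).2 hk
    have h1 : G n n = 0 := by
      rw [windowed, Matrix.of_apply] at h0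
      exact (mul_eq_zero.1 h0).resolve_right (mul_ne_zero hwn (star_ne_zero.2 hwn))
    rw [hG, Matrix.add_apply, vecMulVec_apply, Pi.star_apply,
      add_eq_zero_iff_of_nonneg (mul_star_self_nonneg _) hDpos.diag_nonneg] at h1
    exact ⟨by simpa using h1.1, h1.2⟩
  have hDnm : D n m = 0 := (PosSemidef.apply_eq_zero_of_diag hDpos (hzero n hn).2 m).1
  have hbn : b n = x₀ n := sub_eq_zero.1 (hzero n hn).1
  have hbm : b m = x₀ m := sub_eq_zero.1 (hzero m hm).1
  rw [hD, Matrix.sub_apply, sub_eq_zero] at hDnm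
  rw [hDnm, outer, vecMulVec_apply, vecMulVec_apply, Pi.star_apply, Pi.star_apply, hbn, hbm]

/-- As long as the signal and the diagonal of `X` vanish before the index `c`, the measurements of
a section determine the weighted trace of its new block. -/
lemma trace_windowed_sub_outer {N W L : ℕ} (hL : 1 ≤ L) (hN : 2 * L ≤ N) {w : Fin W → ℂ}
    (hw : ∀ n, w n ≠ 0) {x₀ : Fin N → ℂ} {X : Matrix (Fin N) (Fin N) ℂ} (hX : X.PosSemidef)
    {r c : ℕ} (hXc : ∀ n : Fin N, (n : ℕ) < c → X n n = 0)
    (hxc : ∀ n : Fin N, (n : ℕ) < c → x₀ n = 0) (hr : r * L < c + L)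
    (htrig : ∀ k : ℕ, 1 ≤ k → k ≤ 2 * L → trigSum (windowed w L r (X - outer x₀)) k = 0) :
    (windowed w L r (X - outer x₀)).trace = 0 := by
  refine trace_eq_zero_of_trigSum (c := c) hL hN (fun n m h => ?_) htrig
  rw [windowed, Matrix.of_apply] at h
  have h1 := left_ne_zero_of_mul h
  have h2 := right_ne_zero_of_mul h
  have hn := (shiftedWindow_ne_zero_iff hw L r n).1 (left_ne_zero_of_mul h2)
  have hm := (shiftedWindow_ne_zero_iff hw L r m).1 (star_ne_zero.1 (right_ne_zero_of_mul h2))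
  refine ⟨⟨?_, by omega⟩, ⟨?_, by omega⟩⟩
  · by_contra! hlt
    apply h1
    simp [outer, vecMulVec_apply, hxc n hlt, PosSemidef.apply_eq_zero_of_diag hX (hXc n hlt)]
  · by_contra! hlt
    apply h1
    simp [outer, vecMulVec_apply, hxc m hlt, PosSemidef.apply_eq_zero_of_diag hX (hXc m hlt)]

lemma windowed_sub_outer_diag {N W : ℕ} (w : Fin W → ℂ) (L r : ℕ) (x₀ : Fin N → ℂ)
    (X : Matrix (Fin N) (Fin N) ℂ) (n : Fin N) :
    windowed w L r (X - outer x₀) n n = (X n n - x₀ n * star (x₀ n)) *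
      (shiftedWindow N w L r n * star (shiftedWindow N w L r n)) := by
  rw [windowed, Matrix.of_apply, Matrix.sub_apply, outer, vecMulVec_apply, Pi.star_apply]

/-- Before `i₀` there is no nonzero entry to split off, so only traces are used. The window may
reach past `i₀`, but by fewer than `L` indices, where the prior knowledge cancels the error; the
remaining diagonal terms are nonnegative with sum zero. -/
lemma diag_eq_zero_of_lt {N W L M : ℕ} (hL : 1 ≤ L) {w : Fin W → ℂ} (hw : ∀ n, w n ≠ 0)
    (hLW : 2 * L ≤ W) (hWN : 2 * W ≤ N) (hLM : 4 * L ≤ M) {x₀ : Fin N → ℂ}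
    {X : Matrix (Fin N) (Fin N) ℂ} (hX : IsFeasible w L M x₀ X) {i₀ : Fin N}
    (hx : ∀ n < i₀, x₀ n = 0) (hprior : AgreesWithPrior L x₀ i₀ X) {n : Fin N} (hn : n < i₀) :
    X n n = 0 := by
  obtain ⟨hpos, htrig⟩ := (isFeasible_iff ..).1 hX
  suffices h : ∀ r : ℕ, ∀ n : Fin N, n < i₀ → (n : ℕ) < r * L + 1 → X n n = 0 by
    refine h n n hn ?_
    nlinarith [Nat.zero_le (n : ℕ)]
  have hi₀ := i₀.2
  have hx' : ∀ c : ℕ, c ≤ (i₀ : ℕ) → ∀ n : Fin N, (n : ℕ) < c → x₀ n = 0 := fun c hc n hn =>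
    hx n (Fin.lt_def.2 (by omega))
  have step : ∀ r c : ℕ, c ≤ (i₀ : ℕ) → r * L < c + L → c ≤ r * L →
      (∀ n : Fin N, (n : ℕ) < c → X n n = 0) →
      ∀ n : Fin N, n < i₀ → (n : ℕ) < r * L + 1 → X n n = 0 := by
    intro r c hc hrc hcr hXc n hn hnr
    by_cases hnc : (n : ℕ) < c
    · exact hXc n hnc
    have htr := trace_windowed_sub_outer hL (by omega) hw hpos hXc (hx' c hc) hrc
      (fun k hk hk' => htrig k r hk (by omega) ((lt_numSections_iff hL).2 (by omega)))
    have hterm : ∀ n, 0 ≤ windowed w L r (X - outer x₀) n n := by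
      intro n
      rw [windowed_sub_outer_diag]
      rcases lt_or_ge n i₀ with h | h
      · rw [hx n h, zero_mul, sub_zero]
        exact mul_nonneg hpos.diag_nonneg (mul_star_self_nonneg _)
      · by_cases hw0 : shiftedWindow N w L r n = 0
        · simp [hw0]
        have h2 := ((shiftedWindow_ne_zero_iff hw L r n).1 hw0).1
        rw [hprior n n h (by omega) h (by omega), sub_self, zero_mul]
    have h0 := (Finset.sum_eq_zero_iff_of_nonneg fun n _ => hterm n).1 htr n (Finset.mem_univ n)
    have hwn := (shiftedWindow_ne_zero_iff hw L r n).2 ⟨by omega, by omega⟩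
    rw [windowed_sub_outer_diag, hx n hn, zero_mul, sub_zero] at h0
    exact (mul_eq_zero.1 h0).resolve_right (mul_ne_zero hwn (star_ne_zero.2 hwn))
  intro r
  induction r with
  | zero => exact step 0 0 (by omega) (by omega) (by omega) (fun n hn => by omega)
  | succ r ih =>
    intro n hn hnr
    have hmul : (r + 1) * L = r * L + L := by ring
    by_cases hc : r * L + 1 ≤ (i₀ : ℕ)
    · exact step (r + 1) (r * L + 1) hc (by omega) (by omega)
        (fun n hn => ih n (Fin.lt_def.2 (by omega)) hn) n hn hnr
    · exact ih n hn (by have := Fin.lt_def.1 hn; omega)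

/-- For hop size one the first nonzero entry needs no prior knowledge. -/
lemma agreesWithPrior_one {N W M : ℕ} {w : Fin W → ℂ} (hw : ∀ n, w n ≠ 0)
    (hLW : 2 * 1 ≤ W) (hWN : 2 * W ≤ N) (hLM : 4 * 1 ≤ M) {x₀ : Fin N → ℂ}
    {X : Matrix (Fin N) (Fin N) ℂ} (hX : IsFeasible w 1 M x₀ X) {i₀ : Fin N}
    (hx : ∀ n < i₀, x₀ n = 0) : AgreesWithPrior 1 x₀ i₀ X := by
  obtain ⟨hpos, htrig⟩ := (isFeasible_iff ..).1 hX
  have hdiag : ∀ j : ℕ, ∀ n : Fin N, (n : ℕ) = j → n ≤ i₀ → X n n = x₀ n * star (x₀ n) := by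
    intro j
    induction j using Nat.strong_induction_on with
    | _ j ih =>
      rintro n rfl hn
      have hn' := Fin.le_def.1 hn
      have hxn : ∀ m : Fin N, (m : ℕ) < n → x₀ m = 0 := fun m hm => hx m (Fin.lt_def.2 (by omega))
      have hXn : ∀ m : Fin N, (m : ℕ) < n → X m m = 0 := fun m hm => by
        rw [ih m hm m rfl (Fin.le_def.2 (by omega)), hxn m hm, zero_mul]
      have htr := trace_windowed_sub_outer (r := n) le_rfl (by omega) hw hpos hXn hxn (by omega)
        (fun k hk hk' => htrig k n hk (by omega)
          ((lt_numSections_iff le_rfl).2 (by have := n.2; omega)))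
      -- With hop size one, section `n` has `n` as its only new index, so the trace is a single
      -- term.
      rw [Matrix.trace, Finset.sum_eq_single n, diag_apply, windowed_sub_outer_diag] at htr
      · have hwn := (shiftedWindow_ne_zero_iff hw 1 n n).2 ⟨by omega, by omega⟩
        exact sub_eq_zero.1 ((mul_eq_zero.1 htr).resolve_right
          (mul_ne_zero hwn (star_ne_zero.2 hwn)))
      · intro m _ hm
        rw [diag_apply, windowed_sub_outer_diag]
        rcases lt_or_gt_of_ne (fun h => hm (Fin.ext h) : (m : ℕ) ≠ n) with h | h
        · rw [hXn m h, hxn m h, zero_mul, sub_zero, zero_mul]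
        · have : shiftedWindow N w 1 n m = 0 := by
            by_contra h0
            have := (shiftedWindow_ne_zero_iff hw 1 n m).1 h0
            omega
          rw [this, zero_mul, mul_zero]
      · simp
  intro n m hn hn' hm hm'
  obtain rfl : n = i₀ := by
    ext
    have := Fin.le_def.1 hn
    omega
  obtain rfl : m = n := by
    ext
    have := Fin.le_def.1 hm
    omega
  exact hdiag _ _ rfl le_rfl

/-- The genericity condition on the signal: all the linear systems are invertible in which the
nonzero entry at `a` belongs to the section and is sufficiently far from the new entries. -/
def HasInvertibleSections {N W : ℕ} (w : Fin W → ℂ) (L : ℕ) (x₀ : Fin N → ℂ) : Prop :=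
  ∀ r c : ℕ, ∀ a : Fin N, x₀ a ≠ 0 → (a : ℕ) ≤ r * L → r * L < (a : ℕ) + W →
    (a : ℕ) + L ≤ c → c + L ≤ (a : ℕ) + W →
      (sectionSystem N L c fun k => stft w L x₀ k r).det ≠ 0

/-- Countably many null sets; for `a ∉ S` the condition is vacuous. -/
lemma ae_hasInvertibleSections {N W : ℕ} {w : Fin W → ℂ} (hw : ∀ n, w n ≠ 0) (hWN : 2 * W ≤ N)
    (L : ℕ) (S : Finset (Fin N)) :
    ∀ᵐ v : S → ℂ ∂MeasureTheory.volume, HasInvertibleSections w L (extendZero S v) := by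
  refine MeasureTheory.ae_all_iff.2 fun r => MeasureTheory.ae_all_iff.2 fun c =>
    MeasureTheory.ae_all_iff.2 fun a => ?_
  by_cases h : a ∈ S ∧ (a : ℕ) ≤ r * L ∧ r * L < (a : ℕ) + W ∧ (a : ℕ) + L ≤ c ∧
      c + L ≤ (a : ℕ) + W
  · obtain ⟨hS, h1, h2, h3, h4⟩ := h
    filter_upwards [ae_det_sectionSystem_ne_zero hw hWN S ⟨a, hS⟩ h1 h2 h3 h4] with v hv
    exact fun _ _ _ _ _ => hv
  · refine Filter.Eventually.of_forall fun v hv h1 h2 h3 h4 => absurd ⟨?_, h1, h2, h3, h4⟩ h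
    by_contra hS
    exact hv (by simp [extendZero, hS])

lemma eq_outer_of_isFeasible {N W L M : ℕ} (hL : 1 ≤ L) {w : Fin W → ℂ} (hw : ∀ n, w n ≠ 0)
    (hLW : 2 * L ≤ W) (hWN : 2 * W ≤ N) (hLM : 4 * L ≤ M) {x₀ : Fin N → ℂ}
    (hgen : HasInvertibleSections w L x₀) (hcons : AtMostConsecutiveZeros (W - 2 * L) x₀)
    {i₀ : Fin N} (hi₀ : IsLeast {n : Fin N | x₀ n ≠ 0} i₀) {X : Matrix (Fin N) (Fin N) ℂ}
    (hX : IsFeasible w L M x₀ X) (hprior : AgreesWithPrior L x₀ i₀ X) : X = outer x₀ := by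
  have hxi : x₀ i₀ ≠ 0 := hi₀.1
  have hx : ∀ n < i₀, x₀ n = 0 := fun n hn => by
    by_contra h
    exact absurd (hi₀.2 h) (not_le.2 hn)
  obtain ⟨hpos, htrig⟩ := (isFeasible_iff ..).1 hX
  have hbase : ∀ n m : Fin N, (n : ℕ) < i₀ + L → (m : ℕ) < i₀ + L → X n m = outer x₀ n m := by
    intro n m hn hm
    rw [outer, vecMulVec_apply, Pi.star_apply]
    rcases lt_or_ge n i₀ with h | h
    · rw [hx n h, zero_mul]
      exact (PosSemidef.apply_eq_zero_of_diag hpos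
        (diag_eq_zero_of_lt hL hw hLW hWN hLM hX hx hprior h) m).1
    rcases lt_or_ge m i₀ with h' | h'
    · rw [hx m h', star_zero, mul_zero]
      exact (PosSemidef.apply_eq_zero_of_diag hpos
        (diag_eq_zero_of_lt hL hw hLW hWN hLM hX hx hprior h') n).2
    exact hprior n m h hn h' hm
  have hmain : ∀ r : ℕ, ∀ n m : Fin N, ((n : ℕ) < i₀ + L ∨ (n : ℕ) ≤ r * L) →
      ((m : ℕ) < i₀ + L ∨ (m : ℕ) ≤ r * L) → X n m = outer x₀ n m := by
    intro r
    induction r with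
    | zero => exact fun n m hn hm => hbase n m (by omega) (by omega)
    | succ r ih =>
      intro n m hn hm
      have hmul : (r + 1) * L = r * L + L := by ring
      by_cases hsmall : r * L + L < i₀ + L
      · exact hbase n m (by omega) (by omega)
      by_cases hlast : N ≤ r * L + 1
      · exact ih n m (by have := n.2; omega) (by have := m.2; omega)
      -- The first index not yet known.
      set c := max ((i₀ : ℕ) + L) (r * L + 1) with hc
      obtain ⟨a, hxa, ha1, ha2, ha3, ha4⟩ : ∃ a : Fin N, x₀ a ≠ 0 ∧ (a : ℕ) ≤ (r + 1) * L ∧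
          (r + 1) * L < (a : ℕ) + W ∧ (a : ℕ) + L ≤ c ∧ c + L ≤ (a : ℕ) + W := by
        by_cases hia : (r + 1) * L < (i₀ : ℕ) + W
        · exact ⟨i₀, hxi, by omega, hia, by omega, by omega⟩
        -- The window starts at `(r + 1) * L + 1 - W`. Its first `W - 2 * L + 1` indices end at `c -
        -- L`, so a nonzero entry among them is far enough from the new block.
        · obtain ⟨a, ha, ha', hxa⟩ := hcons ((r + 1) * L + 1 - W) (by omega)
          exact ⟨a, hxa, by omega, by omega, by omega, by omega⟩
      refine eq_outer_of_section hL hw hpos hxi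
        (K := {n : Fin N | (n : ℕ) < i₀ + L ∨ (n : ℕ) ≤ r * L}) (Or.inl (by omega))
        (fun n hn m hm => ih n m hn hm) (r := r + 1) (c := c) (fun n hn h1 _ => ?_)
        (hgen (r + 1) c a hxa ha1 ha2 ha3 ha4)
        (fun k hk hk' => htrig k (r + 1) hk (by omega) ((lt_numSections_iff hL).2 (by omega)))
        ?_ ?_
      · have hn' : ¬((n : ℕ) < i₀ + L ∨ (n : ℕ) ≤ r * L) := hn
        omega
      · change ((n : ℕ) < i₀ + L ∨ (n : ℕ) ≤ r * L) ∨ _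
        omega
      · change ((m : ℕ) < i₀ + L ∨ (m : ℕ) ≤ r * L) ∨ _
        omega
  ext n m
  have hNL : N ≤ N * L := Nat.le_mul_of_pos_right N hL
  -- Since `N ≤ N * L`, stage `N` covers every index.
  exact hmain N n m (by have := n.2; omega) (by have := m.2; omega)

end STliFT

theorem corollary2 (N W L M : ℕ) (hL : 1 ≤ L) (w : Fin W → ℂ)
    (hw : ∀ n, w n ≠ 0)
    (hLW : 2 * L ≤ W) (hWN : 2 * W ≤ N)
    (hLM : 4 * L ≤ M) (hMN : M ≤ N) :
    STliFT.AlmostAllSparse N (fun x₀ =>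
      STliFT.AtMostConsecutiveZeros (W - 2 * L) x₀ →
        (L = 1 → ∀ X : Matrix (Fin N) (Fin N) ℂ,
          STliFT.IsFeasible w L M x₀ X ↔ X = STliFT.outer x₀) ∧
        (∀ i₀ : Fin N, IsLeast {n : Fin N | x₀ n ≠ 0} i₀ →
          ∀ X : Matrix (Fin N) (Fin N) ℂ,
            (STliFT.IsFeasible w L M x₀ X ∧ STliFT.AgreesWithPrior L x₀ i₀ X) ↔
              X = STliFT.outer x₀)) := by
  intro S _
  filter_upwards [STliFT.ae_hasInvertibleSections hw hWN L S] with v hgen _ hcons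
  refine ⟨?_, fun i₀ hi₀ X => ⟨fun ⟨hX, hprior⟩ =>
    STliFT.eq_outer_of_isFeasible hL hw hLW hWN hLM hgen hcons hi₀ hX hprior, ?_⟩⟩
  · rintro rfl X
    refine ⟨fun hX => ?_, ?_⟩
    -- The bound on consecutive zeros is less than `N`, so the signal is nonzero and `i₀` exists.
    · obtain ⟨n, -, -, hn⟩ := hcons 0 (by omega)
      obtain ⟨i₀, hi₀⟩ : ∃ i₀, IsLeast {n : Fin N | STliFT.extendZero S v n ≠ 0} i₀ :=
        ⟨_, WellFounded.min_mem wellFounded_lt _ ⟨n, hn⟩,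
          fun m hm => WellFounded.min_le wellFounded_lt hm⟩
      refine STliFT.eq_outer_of_isFeasible hL hw hLW hWN hLM hgen hcons hi₀ hX
        (STliFT.agreesWithPrior_one hw hLW hWN hLM hX fun n hn => ?_)
      by_contra h
      exact absurd (hi₀.2 h) (not_le.2 hn)
    · rintro rfl
      exact STliFT.isFeasible_outer w 1 M _
  · rintro rfl
    exact ⟨STliFT.isFeasible_outer w L M _, fun _ _ _ _ _ _ => rfl⟩
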